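/- Let $M$ be a closed (compact, without boundary) smooth manifold of dimension $n\ge 1$ with a smooth Riemannian metric, and let $d$ be any metric on $M$ that induces its topology. Let $f\colon M\to M$ be a $C^1$ local diffeomorphism, i.e. $f$ is surjective and every point of $M$ has an open neighbourhood that $f$ maps $C^1$-diffeomorphically onto an open set. Write $\|D_xf\|_{\mathrm{co}}=\min\{\|(D_xf)v\| : v\in T_xM,\ \|v\|=1\}$. For $\lambda>0$ and an integer $m\ge 1$, the orbit string $(x,f(x),\dots,f^m(x))$ of length $m$ is called $\lambda$-quasi-expanding if $$\frac1\ell\sum_{j=1}^{\ell}\log\|D_{f^{m-j}(x)}f\|_{\mathrm{co}}\ge\lambda\qquad\text{for all }\ell=1,\dots,m.$$ Then for all $\varepsilon>0$ and $\lambda>0$ there exists $\delta>0$ such that the following holds. Let $k\ge 0$, let $x_0,\dots,x_k\in M$ and let $n_0,\dots,n_k\ge1$ be integers such that each string $(x_i,f(x_i),\dots,f^{n_i}(x_i))$, $0\le i\le k$, is $\lambda$-quasi-expanding and $d(f^{n_i}(x_i),x_{i+1})<\delta$ for all $0\le i\le k$, where $x_{k+1}=x_0$. Then there is a point $p\in M$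 with $f^{\tau}(p)=p$, where $\tau=n_0+\cdots+n_k$ (not necessarily the minimal period), such that $$d\bigl(f^{\,n_0+\cdots+n_{i-1}+j}(p),\,f^j(x_i)\bigr)<\varepsilon\qquad\text{for all }0\le i\le k,\ 0\le j\le n_i$$ (the sum $n_0+\cdots+n_{i-1}$ being $0$ for $i=0$), and $$\frac1\ell\sum_{j=1}^{\ell}\log\|D_{f^{\tau-j}(p)}f\|_{\mathrm{co}}\ge\lambda-\varepsilon\qquad\text{for all }\ell=1,\dots,\tau.$$ -/

import Mathlib

open scoped Manifold ContDiff Bundle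

noncomputable section

/-- `f` is a `C^1` local diffeomorphism of `M`: it is surjective, and around every point it restricts
to a `C^1` diffeomorphism between open sets. -/
def IsC1LocalDiffeo {n : ℕ} {M : Type*} [TopologicalSpace M]
    [ChartedSpace (EuclideanSpace ℝ (Fin n)) M] (f : M → M) : Prop :=
  Function.Surjective f ∧ IsLocalDiffeomorph (𝓡 n) (𝓡 n) 1 f

/-- The co-norm `‖D_x f‖_co`, the minimum of `‖(D_x f) v‖` over the unit tangent vectors `v` at `x`,
for the norms given by the Riemannian metric. -/
def derivConorm {n : ℕ} {M : Type*} [TopologicalSpace M]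
    [ChartedSpace (EuclideanSpace ℝ (Fin n)) M]
    [Bundle.RiemannianBundle (fun x : M ↦ TangentSpace (𝓡 n) x)] (f : M → M) (x : M) : ℝ :=
  sInf {r : ℝ | ∃ v : TangentSpace (𝓡 n) x, ‖v‖ = 1 ∧ r = ‖mfderiv (𝓡 n) (𝓡 n) f x v‖}

/-- The average of `log ‖Df‖_co` over the points `f^{k-1}(x), …, f^{k-ℓ}(x)`, where `1 ≤ ℓ ≤ k`. -/
def backwardAverage {n : ℕ} {M : Type*} [TopologicalSpace M]
    [ChartedSpace (EuclideanSpace ℝ (Fin n)) M]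
    [Bundle.RiemannianBundle (fun x : M ↦ TangentSpace (𝓡 n) x)]
    (f : M → M) (x : M) (k ℓ : ℕ) : ℝ :=
  (1 / (ℓ : ℝ)) * ∑ j ∈ Finset.Icc 1 ℓ, Real.log (derivConorm (n := n) f (f^[k - j] x))

/-- The orbit string `(x, f(x), …, f^k(x))`, of length `k ≥ 1`, is `lam`-quasi-expanding. -/
def IsQuasiExpandingString {n : ℕ} {M : Type*} [TopologicalSpace M]
    [ChartedSpace (EuclideanSpace ℝ (Fin n)) M]
    [Bundle.RiemannianBundle (fun x : M ↦ TangentSpace (𝓡 n) x)]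
    (f : M → M) (lam : ℝ) (x : M) (k : ℕ) : Prop :=
  1 ≤ k ∧ ∀ ℓ : ℕ, 1 ≤ ℓ → ℓ ≤ k → lam ≤ backwardAverage (n := n) f x k ℓ

end

open Bundle Set

/-! Quasi-expansion of a string makes the inverse branches, pulled back from its end, contract. Let
φ = log ‖Df‖_co, which is continuous. By compactness there is one radius r such that, for the
Riemannian distance, `f` has inverse branches on r-balls about f x with Lipschitz constant exp(η - φ
x), where η = λ/2 (`IsLocalDiffeomorph.exists_hasInverseBranches`). The sums of φ over the last ℓ
points of a string are at least ℓλ, so composing branches backwards never leaves the r-balls, and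
the whole composition contracts by θ = exp(η - λ) < 1 (`HasInverseBranches.exists_string`).

If θr + δ ≤ r, a jump of size δ is absorbed by the contraction, so the branches of successive
strings compose (`HasInverseBranches.exists_chain`). Closing the pseudo-orbit gives a contraction of
a closed ball into itself, and its fixed point is the periodic point
(`HasInverseBranches.exists_isPeriodicPt`).

Along the shadowing orbit φ changes by less than ε, so each string keeps the rate λ - ε; these
bounds concatenate (`le_backward_sum_of_strings`). -/

/-! ### Inverse branches along pseudo-orbits -/

/-- `f` has inverse branches on all closed balls of radius `r` around points `f x`, which expand
distances at most by the factor `exp (η - φ x)`. -/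
def HasInverseBranches {X : Type*} [EMetricSpace X] (f : X → X) (φ : X → ℝ) (η : ℝ)
    (r : ENNReal) : Prop :=
  ∀ x, ∃ g : X → X, g (f x) = x ∧ ∀ y, edist y (f x) ≤ r → f (g y) = y ∧
    ∀ z, edist z (f x) ≤ r →
      edist (g y) (g z) ≤ ENNReal.ofReal (Real.exp (η - φ x)) * edist y z

/-- The inverse branches compose to an inverse branch along a quasi-expanding string. -/
theorem HasInverseBranches.exists_string {X : Type*} [EMetricSpace X] {f : X → X} {φ : X → ℝ}
    {η lam : ℝ} {r : ENNReal} (H : HasInverseBranches f φ η r) (hη : η ≤ lam) (m : ℕ) :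
    ∀ x : X, (∀ ℓ ≤ m, ℓ * lam ≤ ∑ j ∈ Finset.Icc 1 ℓ, φ (f^[m - j] x)) →
    ∃ G : X → X, G (f^[m] x) = x ∧ ∀ y, edist y (f^[m] x) ≤ r → f^[m] (G y) = y ∧
      (∀ j ≤ m, edist (f^[j] (G y)) (f^[j] x) ≤ r) ∧
      ∀ z, edist z (f^[m] x) ≤ r → edist (G y) (G z) ≤
        ENNReal.ofReal (Real.exp (m * η - ∑ j ∈ Finset.Icc 1 m, φ (f^[m - j] x))) *
          edist y z := by
  induction m with
  | zero =>
    intro x _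
    refine ⟨id, rfl, fun y hy ↦ ⟨rfl, fun j hj ↦ ?_, fun z hz ↦ ?_⟩⟩
    · obtain rfl : j = 0 := by omega
      exact hy
    · simp
  | succ m ih =>
    intro x hx
    have key : ∀ ℓ ≤ m, ∑ j ∈ Finset.Icc 1 ℓ, φ (f^[m - j] (f x)) =
        ∑ j ∈ Finset.Icc 1 ℓ, φ (f^[m + 1 - j] x) := fun ℓ hℓ ↦ by
      refine Finset.sum_congr rfl fun j hj ↦ ?_
      rw [Finset.mem_Icc] at hj
      rw [show m + 1 - j = (m - j) + 1 by omega, Function.iterate_succ_apply]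
    -- The averages are counted from the end, so dropping the first point preserves quasi-expansion.
    have hfx : ∀ ℓ ≤ m, ℓ * lam ≤ ∑ j ∈ Finset.Icc 1 ℓ, φ (f^[m - j] (f x)) := fun ℓ hℓ ↦ by
      rw [key ℓ hℓ]
      exact hx ℓ (by omega)
    obtain ⟨G, hG, hGy⟩ := ih (f x) hfx
    obtain ⟨g, hg, hgy⟩ := H x
    have hsum : ∑ j ∈ Finset.Icc 1 (m + 1), φ (f^[m + 1 - j] x) =
        ∑ j ∈ Finset.Icc 1 m, φ (f^[m - j] (f x)) + φ x := by
      rw [Finset.sum_Icc_succ_top (by omega), key m le_rfl]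
      simp
    have hball : ∀ y, edist y (f^[m] (f x)) ≤ r → edist (G y) (f x) ≤ r := fun y hy ↦
      ((hGy y hy).2.1 0 (Nat.zero_le _))
    have hlip : ∀ y, edist y (f^[m + 1] x) ≤ r → ∀ z, edist z (f^[m + 1] x) ≤ r →
        edist (g (G y)) (g (G z)) ≤ ENNReal.ofReal (Real.exp (((m + 1 : ℕ) : ℝ) * η -
          ∑ j ∈ Finset.Icc 1 (m + 1), φ (f^[m + 1 - j] x))) * edist y z := fun y hy z hz ↦ by
      refine ((hgy _ (hball y hy)).2 _ (hball z hz)).trans ?_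
      refine (mul_le_mul_right ((hGy y hy).2.2 z hz) _).trans ?_
      rw [← mul_assoc, ← ENNReal.ofReal_mul (Real.exp_pos _).le, ← Real.exp_add, hsum]
      refine le_of_eq ?_
      congr 3
      push_cast
      ring
    have hfix : g (G (f^[m + 1] x)) = x := by
      rw [Function.iterate_succ_apply, hG, hg]
    refine ⟨g ∘ G, hfix, fun y hy ↦ ⟨?_, ?_, hlip y hy⟩⟩
    · rw [Function.iterate_succ_apply, Function.comp_apply, (hgy _ (hball y hy)).1, (hGy y hy).1]
    · rintro (_ | j) hj
      · have h1 := hlip y hy (f^[m + 1] x) (by simp)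
        rw [hfix] at h1
        refine h1.trans ((mul_le_of_le_one_left (zero_le) ?_).trans hy)
        rw [ENNReal.ofReal_le_one, Real.exp_le_one_iff]
        have := hx (m + 1) le_rfl
        have h2 : ((m + 1 : ℕ) : ℝ) * η ≤ ((m + 1 : ℕ) : ℝ) * lam := by gcongr
        linarith
      · rw [Function.iterate_succ_apply, Function.iterate_succ_apply, Function.comp_apply,
          (hgy _ (hball y hy)).1]
        exact (hGy y hy).2.1 j (by omega)

/-- The inverse branches along the strings of a pseudo-orbit compose to one contraction. -/
theorem HasInverseBranches.exists_chain {X : Type*} [EMetricSpace X] {f : X → X} {φ : X → ℝ}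
    {η lam : ℝ} {r δ : ENNReal} (H : HasInverseBranches f φ η r) (hη : η ≤ lam)
    (hδ : ENNReal.ofReal (Real.exp (η - lam)) * r + δ ≤ r) (x : ℕ → X) (len : ℕ → ℕ) (k : ℕ)
    (hlen : ∀ i ≤ k, 1 ≤ len i)
    (hx : ∀ i ≤ k, ∀ ℓ ≤ len i, ℓ * lam ≤ ∑ j ∈ Finset.Icc 1 ℓ, φ (f^[len i - j] (x i)))
    (hjump : ∀ i < k, edist (x (i + 1)) (f^[len i] (x i)) ≤ δ) :
    ∃ G : X → X, ∀ y, edist y (f^[len k] (x k)) ≤ r →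
      f^[∑ m ∈ Finset.range (k + 1), len m] (G y) = y ∧
      edist (G y) (x 0) ≤ ENNReal.ofReal (Real.exp (η - lam)) * r ∧
      (∀ i ≤ k, ∀ j ≤ len i,
        edist (f^[(∑ m ∈ Finset.range i, len m) + j] (G y)) (f^[j] (x i)) ≤ r) ∧
      ∀ z, edist z (f^[len k] (x k)) ≤ r →
        edist (G y) (G z) ≤ ENNReal.ofReal (Real.exp (η - lam)) * edist y z := by
  have hstring : ∀ i ≤ k, ∃ G : X → X, G (f^[len i] (x i)) = x i ∧
      ∀ y, edist y (f^[len i] (x i)) ≤ r → f^[len i] (G y) = y ∧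
      (∀ j ≤ len i, edist (f^[j] (G y)) (f^[j] (x i)) ≤ r) ∧
      ∀ z, edist z (f^[len i] (x i)) ≤ r →
        edist (G y) (G z) ≤ ENNReal.ofReal (Real.exp (η - lam)) * edist y z := fun i hi ↦ by
    obtain ⟨G, hG, h⟩ := H.exists_string hη (len i) (x i) (hx i hi)
    refine ⟨G, hG, fun y hy ↦ ⟨(h y hy).1, (h y hy).2.1, fun z hz ↦
      ((h y hy).2.2 z hz).trans ?_⟩⟩
    refine mul_le_mul_left (ENNReal.ofReal_le_ofReal (Real.exp_le_exp.2 ?_)) _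
    -- The exponent is at most len i * (η - lam), hence at most η - lam because len i ≥ 1.
    have h1 := hx i hi (len i) le_rfl
    have h2 : (1 : ℝ) ≤ len i := by exact_mod_cast hlen i hi
    have h3 : 0 ≤ ((len i : ℝ) - 1) * (lam - η) :=
      mul_nonneg (sub_nonneg.2 h2) (sub_nonneg.2 hη)
    linarith
  induction k with
  | zero =>
    obtain ⟨G, hG, h⟩ := hstring 0 le_rfl
    refine ⟨G, fun y hy ↦ ⟨by simpa using (h y hy).1, ?_, fun i hi j hj ↦ ?_, (h y hy).2.2⟩⟩
    · have h1 := (h y hy).2.2 _ (by simp : edist (f^[len 0] (x 0)) (f^[len 0] (x 0)) ≤ r)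
      rw [hG] at h1
      exact h1.trans (by gcongr)
    · obtain rfl : i = 0 := by omega
      simpa using (h y hy).2.1 j hj
  | succ k ih =>
    obtain ⟨F, hF⟩ := ih (fun i hi ↦ hlen i (by omega)) (fun i hi ↦ hx i (by omega))
      (fun i hi ↦ hjump i (by omega)) (fun i hi ↦ hstring i (by omega))
    obtain ⟨G, hG, h⟩ := hstring (k + 1) le_rfl
    have hGx : ∀ y, edist y (f^[len (k + 1)] (x (k + 1))) ≤ r →
        edist (G y) (f^[len k] (x k)) ≤ r := fun y hy ↦ by
      have h1 := (h y hy).2.2 _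
        (by simp : edist (f^[len (k + 1)] (x (k + 1))) (f^[len (k + 1)] (x (k + 1))) ≤ r)
      rw [hG] at h1
      -- Contraction brings the point within θr of the start of the last string, and the jump adds
      -- at most δ.
      refine (edist_triangle _ (x (k + 1)) _).trans (le_trans ?_ hδ)
      exact add_le_add (h1.trans (by gcongr)) (hjump k (by omega))
    refine ⟨F ∘ G, fun y hy ↦ ?_⟩
    obtain ⟨hF1, hF2, hF3, hF4⟩ := hF (G y) (hGx y hy)
    refine ⟨?_, hF2, fun i hi j hj ↦ ?_, fun z hz ↦ ?_⟩
    · rw [Finset.sum_range_succ, add_comm, Function.iterate_add_apply, Function.comp_apply, hF1,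
        (h y hy).1]
    · rcases Nat.lt_or_ge k i with hki | hki
      · obtain rfl : i = k + 1 := by omega
        rw [add_comm, Function.iterate_add_apply, Function.comp_apply, hF1]
        exact (h y hy).2.1 j hj
      · exact hF3 i hki j hj
    · refine (hF4 (G z) (hGx z hz)).trans (mul_le_mul_right (((h y hy).2.2 z hz).trans ?_) _)
      refine mul_le_of_le_one_left zero_le ?_
      rw [ENNReal.ofReal_le_one, Real.exp_le_one_iff]
      linarith

/-- A closed pseudo-orbit made of quasi-expanding strings is shadowed by a periodic orbit. -/
theorem HasInverseBranches.exists_isPeriodicPt {X : Type*} [EMetricSpace X] [CompleteSpace X]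
    {f : X → X} {φ : X → ℝ} {η lam : ℝ} {r δ : ENNReal} (H : HasInverseBranches f φ η r)
    (hη : η < lam) (hr : r ≠ ⊤)
    (hδ : ENNReal.ofReal (Real.exp (η - lam)) * r + δ ≤ r) (x : ℕ → X) (len : ℕ → ℕ) (k : ℕ)
    (hlen : ∀ i ≤ k, 1 ≤ len i)
    (hx : ∀ i ≤ k, ∀ ℓ ≤ len i, ℓ * lam ≤ ∑ j ∈ Finset.Icc 1 ℓ, φ (f^[len i - j] (x i)))
    (hk : x (k + 1) = x 0)
    (hjump : ∀ i ≤ k, edist (x (i + 1)) (f^[len i] (x i)) ≤ δ) :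
    ∃ p, Function.IsPeriodicPt f (∑ m ∈ Finset.range (k + 1), len m) p ∧
      ∀ i ≤ k, ∀ j ≤ len i,
        edist (f^[(∑ m ∈ Finset.range i, len m) + j] p) (f^[j] (x i)) ≤ r := by
  obtain ⟨G, hG⟩ := H.exists_chain hη.le hδ x len k hlen hx (fun i hi ↦ hjump i hi.le)
  set c := f^[len k] (x k) with hc
  set s : Set X := Metric.closedEBall c r with hs
  have hmaps : Set.MapsTo G s s := fun y hy ↦ by
    refine (edist_triangle _ (x 0) _).trans (le_trans ?_ hδ)
    refine add_le_add (hG y hy).2.1 ?_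
    rw [← hk]
    exact hjump k le_rfl
  have hexp : Real.exp (η - lam) < 1 := by
    rw [Real.exp_lt_one_iff]
    linarith
  have hcontr : ContractingWith (Real.toNNReal (Real.exp (η - lam)))
      (hmaps.restrict G s s) := by
    refine ⟨by rwa [← NNReal.coe_lt_coe, Real.coe_toNNReal _ (Real.exp_pos _).le,
      NNReal.coe_one], fun y z ↦ ?_⟩
    exact (hG y y.2).2.2.2 z z.2
  have hcs : c ∈ s := by simp [hs]
  have hclosed : IsClosed s := Metric.isClosed_closedEBall
  -- In an extended metric space the fixed point theorem needs a starting point at finite distance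
  -- from its image, hence `r ≠ ⊤`.
  obtain ⟨p, hps, hp, -⟩ := hcontr.exists_fixedPoint' hclosed.isComplete hmaps hcs
    (ne_top_of_le_ne_top hr (by rw [edist_comm]; exact hmaps hcs))
  have h := hG p hps
  rw [hp] at h
  exact ⟨p, h.1, h.2.2.1⟩

/-! ### Backward sums over concatenated strings -/

/-- Backward sums along a concatenation of strings are bounded below as soon as those along each
string are. -/
theorem le_backward_sum_of_strings (a : ℕ → ℝ) (c : ℝ) (len : ℕ → ℕ) (k : ℕ)
    (h : ∀ i ≤ k, ∀ ℓ ≤ len i,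
      ℓ * c ≤ ∑ j ∈ Finset.Icc 1 ℓ, a ((∑ m ∈ Finset.range i, len m) + (len i - j))) :
    ∀ ℓ ≤ ∑ m ∈ Finset.range (k + 1), len m,
      ℓ * c ≤ ∑ j ∈ Finset.Icc 1 ℓ, a (∑ m ∈ Finset.range (k + 1), len m - j) := by
  have hlast : ∀ i ≤ k, ∀ ℓ ≤ len i,
      ℓ * c ≤ ∑ j ∈ Finset.Icc 1 ℓ, a (∑ m ∈ Finset.range (i + 1), len m - j) :=
    fun i hi ℓ hℓ ↦ by
      refine (h i hi ℓ hℓ).trans_eq (Finset.sum_congr rfl fun j hj ↦ ?_)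
      rw [Finset.mem_Icc] at hj
      rw [Finset.sum_range_succ, Nat.add_sub_assoc (by omega)]
  clear h
  induction k with
  | zero =>
    intro ℓ hℓ
    exact hlast 0 le_rfl ℓ (by simpa using hℓ)
  | succ k ih =>
    intro ℓ hℓ
    rcases le_or_gt ℓ (len (k + 1)) with hle | hgt
    · exact hlast (k + 1) le_rfl ℓ hle
    -- The sum covers the whole last string and the final q + 1 terms of the earlier ones.
    · obtain ⟨q, rfl⟩ := Nat.exists_eq_add_of_lt hgt
      have h1 := hlast (k + 1) le_rfl _ le_rfl
      rw [Finset.sum_range_succ] at hℓ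
      have h2 := ih (fun i hi ↦ hlast i (by omega)) (q + 1) (by omega)
      have hsplit : ∑ j ∈ Finset.Icc 1 (len (k + 1) + q + 1),
          a (∑ m ∈ Finset.range (k + 1 + 1), len m - j) =
          ∑ j ∈ Finset.Icc 1 (len (k + 1)), a (∑ m ∈ Finset.range (k + 1 + 1), len m - j) +
          ∑ j ∈ Finset.Icc 1 (q + 1), a (∑ m ∈ Finset.range (k + 1), len m - j) := by
        rw [← Finset.Ico_succ_right_eq_Icc, ← Finset.Ico_succ_right_eq_Icc,
          ← Finset.Ico_succ_right_eq_Icc,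
          ← Finset.sum_Ico_consecutive _ (show 1 ≤ Order.succ (len (k + 1)) from by simp)
            (show Order.succ (len (k + 1)) ≤ Order.succ (len (k + 1) + q + 1) from by
              simp only [Nat.succ_eq_succ]; omega)]
        congr 1
        rw [Finset.sum_Ico_eq_sum_range, Finset.sum_Ico_eq_sum_range]
        simp only [Nat.succ_eq_succ]
        refine Finset.sum_congr (by congr 1; omega) fun j _ ↦ ?_
        rw [Finset.sum_range_succ _ (k + 1)]
        congr 1
        omega
      rw [hsplit]
      push_cast at h2 ⊢
      linarith

/-! ### Continuity and positivity of the co-norm -/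

/-- The co-norm of a homogeneous map, computed through a homogeneous parametrization of its
source. -/
theorem setOf_norm_eq_image_sphere {V T T' : Type*} [NormedAddCommGroup V] [NormedSpace ℝ V]
    [NormedAddCommGroup T] [NormedSpace ℝ T] [NormedAddCommGroup T'] [NormedSpace ℝ T']
    (A : V → T) (B : T → V) (D : T → T') (hA : ∀ (c : ℝ) v, A (c • v) = c • A v)
    (hB : ∀ (c : ℝ) v, B (c • v) = c • B v)
    (hD : ∀ (c : ℝ) v, D (c • v) = c • D v) (hAB : ∀ v, A (B v) = v) (hBA : ∀ v, B (A v) = v) :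
    {r : ℝ | ∃ v : T, ‖v‖ = 1 ∧ r = ‖D v‖} =
      range fun w : Metric.sphere (0 : V) 1 ↦ ‖D (A w)‖ / ‖A w‖ := by
  have hA0 : A 0 = 0 := by simpa using hA 0 0
  have hB0 : B 0 = 0 := by simpa using hB 0 0
  ext r
  constructor
  · rintro ⟨v, hv, rfl⟩
    have hv0 : B v ≠ 0 := fun h ↦ by
      have := hAB v
      rw [h, hA0] at this
      simp [← this] at hv
    have hn : ‖B v‖ ≠ 0 := norm_ne_zero_iff.2 hv0
    refine ⟨⟨‖B v‖⁻¹ • B v, by simp [norm_smul, hn]⟩, ?_⟩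
    simp only [hA, hAB, hD, norm_smul, hv, norm_inv, norm_norm]
    field_simp
  · rintro ⟨⟨w, hw⟩, rfl⟩
    have hn : ‖A w‖ ≠ 0 := norm_ne_zero_iff.2 fun h ↦ by
      have := hBA w
      rw [h, hB0] at this
      simp [← this] at hw
    refine ⟨‖A w‖⁻¹ • A w, by simp [norm_smul, hn], ?_⟩
    simp only [hD, norm_smul, norm_inv, norm_norm]
    rw [div_eq_inv_mul]

section

variable {n : ℕ} {M : Type*} [TopologicalSpace M] [ChartedSpace (EuclideanSpace ℝ (Fin n)) M]
  [Bundle.RiemannianBundle (fun x : M ↦ TangentSpace (𝓡 n) x)]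

theorem derivConorm_mul_norm_le (f : M → M) (x : M) (v : TangentSpace (𝓡 n) x) :
    derivConorm (n := n) f x * ‖v‖ ≤ ‖mfderiv (𝓡 n) (𝓡 n) f x v‖ := by
  rcases eq_or_ne v 0 with rfl | hv
  · simp
  have hn : ‖v‖ ≠ 0 := norm_ne_zero_iff.2 hv
  have h : derivConorm (n := n) f x ≤ ‖mfderiv (𝓡 n) (𝓡 n) f x (‖v‖⁻¹ • v)‖ :=
    csInf_le ⟨0, fun _ ⟨_, _, hr⟩ ↦ hr ▸ norm_nonneg _⟩
      ⟨‖v‖⁻¹ • v, by rw [norm_smul]; simp [hn], rfl⟩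
  rw [map_smul, norm_smul, norm_inv, norm_norm, inv_mul_eq_div] at h
  exact (le_div_iff₀ (lt_of_le_of_ne (norm_nonneg _) hn.symm)).1 h

variable [IsManifold (𝓡 n) 1 M]

/-- Replaces the unit sphere of the varying norm by the fixed compact sphere of the model space; the
quotient compensates for the normalization. -/
theorem setOf_norm_mfderiv_eq_range_trivializationAt (f : M → M) (x₀ : M) {x : M}
    (hx : x ∈ (trivializationAt (EuclideanSpace ℝ (Fin n)) (TangentSpace (𝓡 n)) x₀).baseSet) :
    {r : ℝ | ∃ v : TangentSpace (𝓡 n) x, ‖v‖ = 1 ∧ r = ‖mfderiv (𝓡 n) (𝓡 n) f x v‖} =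
      range fun w : Metric.sphere (0 : EuclideanSpace ℝ (Fin n)) 1 ↦
      ‖mfderiv (𝓡 n) (𝓡 n) f x ((trivializationAt (EuclideanSpace ℝ (Fin n))
        (TangentSpace (𝓡 n)) x₀).symmL ℝ x w)‖ /
      ‖(trivializationAt (EuclideanSpace ℝ (Fin n)) (TangentSpace (𝓡 n)) x₀).symmL ℝ x w‖ := by
  set e := trivializationAt (EuclideanSpace ℝ (Fin n)) (TangentSpace (𝓡 n)) x₀
  exact setOf_norm_eq_image_sphere (e.symmL ℝ x) (e.continuousLinearMapAt ℝ x)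
    (mfderiv (𝓡 n) (𝓡 n) f x) (fun c v ↦ map_smul _ c v) (fun c v ↦ map_smul _ c v)
    (fun c v ↦ map_smul _ c v) (fun v ↦ e.symmL_continuousLinearMapAt hx v)
    (fun v ↦ e.continuousLinearMapAt_symmL hx v)

variable
  [IsContinuousRiemannianBundle (EuclideanSpace ℝ (Fin n)) (fun x : M ↦ TangentSpace (𝓡 n) x)]

theorem continuous_norm_tangentBundle :
    Continuous fun p : TangentBundle (𝓡 n) M ↦ ‖p.2‖ := by
  have h : Continuous fun p : TangentBundle (𝓡 n) M ↦ inner ℝ p.2 p.2 :=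
    Continuous.inner_bundle (F := EuclideanSpace ℝ (Fin n))
      (E := fun x : M ↦ TangentSpace (𝓡 n) x) (b := fun p : TangentBundle (𝓡 n) M ↦ p.1)
      (v := fun p ↦ p.2) (w := fun p ↦ p.2) continuous_id continuous_id
  refine h.sqrt.congr fun p ↦ ?_
  rw [real_inner_self_eq_norm_sq, Real.sqrt_sq (norm_nonneg _)]

theorem continuous_norm_mfderiv_symmL {f : M → M} (hf : ContMDiff (𝓡 n) (𝓡 n) 1 f) (x₀ : M) :
    Continuous fun q : (trivializationAt (EuclideanSpace ℝ (Fin n))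
        (TangentSpace (𝓡 n) : M → Type _) x₀).baseSet ×
        Metric.sphere (0 : EuclideanSpace ℝ (Fin n)) 1 ↦
      ‖mfderiv (𝓡 n) (𝓡 n) f q.1 ((trivializationAt (EuclideanSpace ℝ (Fin n))
        (TangentSpace (𝓡 n)) x₀).symmL ℝ q.1 q.2)‖ /
      ‖(trivializationAt (EuclideanSpace ℝ (Fin n)) (TangentSpace (𝓡 n)) x₀).symmL ℝ
        q.1.1 q.2‖ := by
  set e := trivializationAt (EuclideanSpace ℝ (Fin n)) (TangentSpace (𝓡 n) : M → Type _) x₀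
  have hs : Continuous fun q : e.baseSet × Metric.sphere (0 : EuclideanSpace ℝ (Fin n)) 1 ↦
      (⟨q.1, e.symmL ℝ q.1 q.2⟩ : TangentBundle (𝓡 n) M) := by
    have h : Continuous fun q : e.baseSet × Metric.sphere (0 : EuclideanSpace ℝ (Fin n)) 1 ↦
        e.toOpenPartialHomeomorph.symm ((q.1 : M), (q.2 : EuclideanSpace ℝ (Fin n))) := by
      refine e.toOpenPartialHomeomorph.symm.continuousOn.comp_continuous
        (by fun_prop) fun q ↦ ?_
      exact e.mem_target.2 q.1.2
    refine h.congr fun q ↦ ?_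
    rw [e.symm_apply_eq_mk_continuousLinearEquivAt_symm (R := ℝ) _ q.1.2,
      e.symm_continuousLinearEquivAt_eq q.1.2]
  refine (continuous_norm_tangentBundle.comp
    ((hf.continuous_tangentMap le_rfl).comp hs)).div
    (continuous_norm_tangentBundle.comp hs) fun q ↦ ?_
  refine norm_ne_zero_iff.2 fun h ↦ ?_
  have h1 := e.continuousLinearMapAt_symmL (R := ℝ) q.1.2 (q.2 : EuclideanSpace ℝ (Fin n))
  have h2 : (q.2 : EuclideanSpace ℝ (Fin n)) = 0 := by
    rw [← h1]
    exact (congrArg _ h).trans (map_zero _)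
  have h3 := q.2.2
  simp [h2] at h3

/-- In a trivialization the co-norm is the infimum over a fixed compact sphere of a jointly
continuous function. -/
theorem continuous_derivConorm {f : M → M} (hf : ContMDiff (𝓡 n) (𝓡 n) 1 f) :
    Continuous (derivConorm (n := n) f) := by
  refine continuous_iff_continuousAt.2 fun x₀ ↦ ?_
  set e := trivializationAt (EuclideanSpace ℝ (Fin n)) (TangentSpace (𝓡 n) : M → Type _) x₀
  have hcont := (isCompact_univ (X := Metric.sphere (0 : EuclideanSpace ℝ (Fin n))
    1)).continuous_sInf (K := univ)
    (f := fun (x : e.baseSet) (w : Metric.sphere (0 : EuclideanSpace ℝ (Fin n)) 1) ↦ ‖mfderiv (𝓡 n) (𝓡 n) f x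
      (e.symmL ℝ x w)‖ / ‖e.symmL ℝ x.1 w‖) (continuous_norm_mfderiv_symmL hf x₀)
  have hon : ContinuousOn (derivConorm (n := n) f) e.baseSet := by
    rw [continuousOn_iff_continuous_domRestrict]
    refine hcont.congr fun x ↦ ?_
    rw [Set.domRestrict_apply, derivConorm, setOf_norm_mfderiv_eq_range_trivializationAt f x₀ x.2,
      image_univ]
  exact hon.continuousAt (e.open_baseSet.mem_nhds (FiberBundle.mem_baseSet_trivializationAt' x₀))

/-- By compactness the infimum is attained, and the derivative is injective. For n = 0 the set would
be empty and its `sInf` equal to 0. -/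
theorem derivConorm_pos (hn : 1 ≤ n) {f : M → M} (hf : IsLocalDiffeomorph (𝓡 n) (𝓡 n) 1 f)
    (x : M) : 0 < derivConorm (n := n) f x := by
  have hx := FiberBundle.mem_baseSet_trivializationAt' (F := EuclideanSpace ℝ (Fin n))
    (E := (TangentSpace (𝓡 n) : M → Type _)) x
  have hnt : Nontrivial (EuclideanSpace ℝ (Fin n)) := by
    have : Nonempty (Fin n) := ⟨⟨0, hn⟩⟩
    infer_instance
  have hne : Nonempty (Metric.sphere (0 : EuclideanSpace ℝ (Fin n)) 1) :=
    (NormedSpace.sphere_nonempty.2 zero_le_one).to_subtype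
  have hcont := (continuous_norm_mfderiv_symmL hf.contMDiff x).comp
    (Continuous.prodMk (continuous_const (y := (⟨x, hx⟩ : (trivializationAt
      (EuclideanSpace ℝ (Fin n)) (TangentSpace (𝓡 n) : M → Type _) x).baseSet))) continuous_id)
  have hmem : derivConorm (n := n) f x ∈
      {r : ℝ | ∃ v : TangentSpace (𝓡 n) x, ‖v‖ = 1 ∧ r = ‖mfderiv (𝓡 n) (𝓡 n) f x v‖} := by
    refine IsCompact.sInf_mem ?_ ?_ <;> rw [setOf_norm_mfderiv_eq_range_trivializationAt f x hx]
    · exact isCompact_range hcont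
    · exact range_nonempty _
  obtain ⟨v, hv, hr⟩ := hmem
  rw [hr]
  refine norm_pos_iff.2 fun h ↦ ?_
  have h0 : v = 0 := (hf.mfderivToContinuousLinearEquiv one_ne_zero x).injective
    (h.trans (map_zero (mfderiv (𝓡 n) (𝓡 n) f x)).symm)
  simp [h0] at hv

end

/-! ### Local inverse branches for the Riemannian distance -/

open scoped Topology in
open Manifold MeasureTheory in
/-- A `C^1` map whose derivative is bounded by `C` on a ball is `C`-Lipschitz on the ball of a third
of the radius, for the Riemannian distance. -/
theorem edist_le_mul_edist_of_enorm_mfderiv_le {n : ℕ} {M : Type*} [EMetricSpace M]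
    [ChartedSpace (EuclideanSpace ℝ (Fin n)) M]
    [Bundle.RiemannianBundle (fun x : M ↦ TangentSpace (𝓡 n) x)]
    [IsManifold (𝓡 n) 1 M] [IsRiemannianManifold (𝓡 n) M]
    {g : M → M} {c : M} {R C : ENNReal} (hC0 : C ≠ 0) (hC : C ≠ ⊤)
    (hg : ContMDiffOn (𝓡 n) (𝓡 n) 1 g (Metric.eball c (3 * R)))
    (hgC : ∀ w ∈ Metric.eball c (3 * R), ∀ v : TangentSpace (𝓡 n) w,
      ‖mfderiv (𝓡 n) (𝓡 n) g w v‖ₑ ≤ C * ‖v‖ₑ)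
    {y z : M} (hy : y ∈ Metric.eball c R) (hz : z ∈ Metric.eball c R) :
    edist (g y) (g z) ≤ C * edist y z := by
  have hyz : edist y z < 2 * R := by
    rw [two_mul]
    exact (edist_triangle_right y z c).trans_lt (ENNReal.add_lt_add hy hz)
  -- Minimizing paths need not exist, so the distance is approximated from above by L.
  suffices h : ∀ L, edist y z < L → L ≤ 2 * R → edist (g y) (g z) ≤ C * L by
    rw [mul_comm, ← ENNReal.div_le_iff_le_mul (.inl hC0) (.inl hC)]
    refine le_of_forall_gt_imp_ge_of_dense fun L hL ↦ ?_
    refine le_trans ?_ (min_le_left L (2 * R))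
    rw [ENNReal.div_le_iff_le_mul (.inl hC0) (.inl hC), mul_comm]
    exact h _ (lt_min hL hyz) (min_le_right _ _)
  intro L hL hLR
  rw [IsRiemannianManifold.out (I := 𝓡 n) y z] at hL
  obtain ⟨γ, hγ0, hγ1, hγ, hlen⟩ := exists_lt_of_riemannianEDist_lt hL
  -- A path of length below 2R starting within R of c stays within 3R of c.
  have hmem : MapsTo γ (Icc 0 1) (Metric.eball c (3 * R)) := fun t ht ↦ by
    have h1 : edist y (γ t) ≤ pathELength (𝓡 n) γ 0 t := by
      rw [IsRiemannianManifold.out (I := 𝓡 n) y (γ t)]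
      exact riemannianEDist_le_pathELength (hγ.mono (Icc_subset_Icc_right ht.2)) hγ0 rfl ht.1
    have h2 : edist (γ t) y < 2 * R := by
      rw [edist_comm]
      exact (h1.trans (pathELength_mono le_rfl ht.2)).trans_lt (hlen.trans_le hLR)
    have h3 : (3 : ENNReal) * R = 2 * R + R := by ring
    rw [Metric.mem_eball, h3]
    exact (edist_triangle _ y _).trans_lt (ENNReal.add_lt_add h2 hy)
  have hle : edist (g y) (g z) ≤ pathELength (𝓡 n) (g ∘ γ) 0 1 := by
    rw [IsRiemannianManifold.out (I := 𝓡 n) (g y) (g z)]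
    exact riemannianEDist_le_pathELength (hg.comp hγ hmem) (by simp [hγ0]) (by simp [hγ1])
      zero_le_one
  refine hle.trans (le_trans ?_ (mul_le_mul_right hlen.le C))
  rw [pathELength_eq_lintegral_mfderiv_Ioo, pathELength_eq_lintegral_mfderiv_Ioo,
    ← lintegral_const_mul' _ _ hC]
  refine setLIntegral_mono' measurableSet_Ioo fun t ht ↦ ?_
  have htI : t ∈ Icc (0 : ℝ) 1 := Ioo_subset_Icc_self ht
  have hγt : MDifferentiableAt 𝓘(ℝ, ℝ) (𝓡 n) γ t :=
    (hγ.contMDiffAt (Icc_mem_nhds ht.1 ht.2)).mdifferentiableAt one_ne_zero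
  have hgt : MDifferentiableAt (𝓡 n) (𝓡 n) g (γ t) :=
    (hg.contMDiffAt (Metric.isOpen_eball.mem_nhds (hmem htI))).mdifferentiableAt one_ne_zero
  rw [mfderiv_comp_apply t hgt hγt]
  exact hgC _ (hmem htI) _

open scoped Topology in
/-- The derivative of a right inverse `g` of `f` is bounded by the inverse of the co-norm. -/
theorem derivConorm_mul_norm_mfderiv_le {n : ℕ} {M : Type*} [TopologicalSpace M]
    [ChartedSpace (EuclideanSpace ℝ (Fin n)) M]
    [Bundle.RiemannianBundle (fun x : M ↦ TangentSpace (𝓡 n) x)]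
    {f g : M → M} {w : M} (hg : MDifferentiableAt (𝓡 n) (𝓡 n) g w)
    (hf : MDifferentiableAt (𝓡 n) (𝓡 n) f (g w)) (hfg : f ∘ g =ᶠ[𝓝 w] id)
    (u : TangentSpace (𝓡 n) w) :
    derivConorm (n := n) f (g w) * ‖mfderiv (𝓡 n) (𝓡 n) g w u‖ ≤ ‖u‖ := by
  refine (derivConorm_mul_norm_le f (g w) _).trans_eq ?_
  rw [← mfderiv_comp_apply w hf hg]
  have h1 : mfderiv (𝓡 n) (𝓡 n) (f ∘ g) w u = (u : EuclideanSpace ℝ (Fin n)) := by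
    rw [hfg.mfderiv_eq, mfderiv_id]
    rfl
  -- The tangent spaces at (f ∘ g) w and w are the same type, but their norms agree only through
  -- equality of the base points.
  have h2 : ∀ (a b : M) (_ : a = b) (e : EuclideanSpace ℝ (Fin n)),
      ‖(show TangentSpace (𝓡 n) a from e)‖ = ‖(show TangentSpace (𝓡 n) b from e)‖ := by
    rintro a _ rfl e
    rfl
  exact (congrArg (fun e : TangentSpace (𝓡 n) ((f ∘ g) w) ↦ ‖e‖) h1).trans (h2 _ _ hfg.eq_of_nhds u)

theorem HasInverseBranches.mono {X : Type*} [EMetricSpace X] {f : X → X} {φ : X → ℝ} {η : ℝ}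
    {r r' : ENNReal} (H : HasInverseBranches f φ η r) (h : r' ≤ r) :
    HasInverseBranches f φ η r' := fun x ↦ by
  obtain ⟨g, hg, hgy⟩ := H x
  exact ⟨g, hg, fun y hy ↦ ⟨(hgy y (hy.trans h)).1, fun z hz ↦ (hgy y (hy.trans h)).2 z
    (hz.trans h)⟩⟩

open scoped Topology in
theorem IsLocalDiffeomorph.exists_hasInverseBranches {n : ℕ} (hn : 1 ≤ n) {M : Type*}
    [EMetricSpace M] [CompactSpace M] [ChartedSpace (EuclideanSpace ℝ (Fin n)) M]
    [Bundle.RiemannianBundle (fun x : M ↦ TangentSpace (𝓡 n) x)]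
    [IsManifold (𝓡 n) 1 M] [IsRiemannianManifold (𝓡 n) M]
    [IsContinuousRiemannianBundle (EuclideanSpace ℝ (Fin n)) (fun x : M ↦ TangentSpace (𝓡 n) x)]
    {f : M → M} (hf : IsLocalDiffeomorph (𝓡 n) (𝓡 n) 1 f) {η : ℝ} (hη : 0 < η) :
    ∃ r > 0, HasInverseBranches f (fun x ↦ Real.log (derivConorm (n := n) f x)) η r := by
  set φ : M → ℝ := fun x ↦ Real.log (derivConorm (n := n) f x)
  have hφ : Continuous φ := (continuous_derivConorm hf.contMDiff).log
    fun x ↦ (derivConorm_pos hn hf x).ne'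
  suffices h : ∃ r > (0 : ENNReal), ∀ x ∈ (univ : Set M), ∃ g : M → M, g (f x) = x ∧
      ∀ y, edist y (f x) ≤ r → f (g y) = y ∧ ∀ z, edist z (f x) ≤ r →
        edist (g y) (g z) ≤ ENNReal.ofReal (Real.exp (η - φ x)) * edist y z by
    obtain ⟨r, hr, h⟩ := h
    exact ⟨r, hr, fun x ↦ h x (mem_univ x)⟩
  -- The property passes to subsets and finite unions, so a uniform r need only be found near each
  -- point.
  refine isCompact_univ.induction_on (p := fun s ↦ ∃ r > (0 : ENNReal), ∀ x ∈ s, ∃ g : M → M,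
    g (f x) = x ∧ ∀ y, edist y (f x) ≤ r → f (g y) = y ∧ ∀ z, edist z (f x) ≤ r →
      edist (g y) (g z) ≤ ENNReal.ofReal (Real.exp (η - φ x)) * edist y z)
    ⟨1, one_pos, fun x hx ↦ hx.elim⟩ ?_ ?_ ?_
  · rintro s t hst ⟨r, hr, h⟩
    exact ⟨r, hr, fun x hx ↦ h x (hst hx)⟩
  · rintro s t ⟨r, hr, h⟩ ⟨r', hr', h'⟩
    refine ⟨min r r', lt_min hr hr', fun x hx ↦ ?_⟩
    rcases hx with hx | hx
    · obtain ⟨g, hg, hgy⟩ := h x hx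
      exact ⟨g, hg, fun y hy ↦ ⟨(hgy y (hy.trans (min_le_left _ _))).1, fun z hz ↦
        (hgy y (hy.trans (min_le_left _ _))).2 z (hz.trans (min_le_left _ _))⟩⟩
    · obtain ⟨g, hg, hgy⟩ := h' x hx
      exact ⟨g, hg, fun y hy ↦ ⟨(hgy y (hy.trans (min_le_right _ _))).1, fun z hz ↦
        (hgy y (hy.trans (min_le_right _ _))).2 z (hz.trans (min_le_right _ _))⟩⟩
  intro x₀ _
  obtain ⟨Φ, hx₀, heq⟩ := hf x₀
  set e := Φ.toOpenPartialHomeomorph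
  have hfe : ∀ x ∈ e.source, f x = e x := fun x hx ↦ heq hx
  have hV : e.source ∩ {x | |φ x - φ x₀| < η / 2} ∈ 𝓝 x₀ := by
    refine Filter.inter_mem (e.open_source.mem_nhds hx₀) ?_
    exact (isOpen_lt (by fun_prop) continuous_const).mem_nhds (by simp [hη])
  have hW : e.target ∩ {y | |φ (e.symm y) - φ x₀| < η / 2} ∈ 𝓝 (f x₀) := by
    rw [hfe x₀ hx₀]
    have ht : e x₀ ∈ e.target := e.map_source hx₀
    refine Filter.inter_mem (e.open_target.mem_nhds ht) ?_
    have hc : ContinuousAt (fun y ↦ φ (e.symm y)) (e x₀) :=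
      hφ.continuousAt.comp (e.continuousAt_symm ht)
    have h0 : φ (e.symm (e x₀)) = φ x₀ := by rw [e.left_inv hx₀]
    have := Metric.tendsto_nhds.1 hc (η / 2) (half_pos hη)
    filter_upwards [this] with y hy
    rwa [h0, Real.dist_eq] at hy
  obtain ⟨ρ, hρ, hρW⟩ := EMetric.mem_nhds_iff.1 hW
  -- With f x within R of f x₀, the 3R-ball about f x lies in the ρ-ball; the minimum with 1 keeps R
  -- finite.
  set R : ENNReal := min ρ 1 / 4 with hR
  have hR0 : R ≠ 0 := (ENNReal.div_pos (lt_min hρ one_pos).ne' (by simp)).ne'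
  have hRtop : R ≠ ⊤ := ENNReal.div_ne_top (ne_top_of_le_ne_top ENNReal.one_ne_top
    (min_le_right _ _)) (by simp)
  have h4R : 3 * R + R ≤ ρ := by
    have : 3 * R + R = R * 4 := by ring
    rw [this, hR, ENNReal.div_mul_cancel (by simp) (by simp)]
    exact min_le_left _ _
  have hnear : {x | f x ∈ Metric.eball (f x₀) R} ∈ 𝓝 x₀ :=
    hf.contMDiff.continuous.continuousAt (Metric.eball_mem_nhds _ (pos_iff_ne_zero.2 hR0))
  refine ⟨_, mem_nhdsWithin_of_mem_nhds (Filter.inter_mem hV hnear), R / 2,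
    ENNReal.half_pos hR0, fun x hx ↦ ?_⟩
  obtain ⟨⟨hxs, hxφ⟩, hxR⟩ := hx
  have hsub : Metric.eball (f x) (3 * R) ⊆
      e.target ∩ {y | |φ (e.symm y) - φ x₀| < η / 2} := fun w hw ↦ hρW <| by
    refine (edist_triangle _ (f x) _).trans_lt (lt_of_lt_of_le ?_ h4R)
    exact ENNReal.add_lt_add hw hxR
  have hball : ∀ y, edist y (f x) ≤ R / 2 → y ∈ Metric.eball (f x) R := fun y hy ↦
    hy.trans_lt (ENNReal.half_lt_self hR0 hRtop)
  have hball3 : Metric.eball (f x) R ⊆ Metric.eball (f x) (3 * R) :=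
    Metric.eball_subset_eball (le_mul_of_one_le_left zero_le (by norm_num))
  have hfg : ∀ y ∈ e.target, f (e.symm y) = y := fun y hy ↦ by
    rw [hfe _ (e.map_target hy), e.right_inv hy]
  have hsmooth : ContMDiffOn (𝓡 n) (𝓡 n) 1 e.symm e.target := Φ.contMDiffOn_invFun
  refine ⟨e.symm, by rw [hfe x hxs, e.left_inv hxs], fun y hy ↦
    ⟨hfg y (hsub (hball3 (hball y hy))).1, fun z hz ↦ ?_⟩⟩
  refine edist_le_mul_edist_of_enorm_mfderiv_le (by simp [Real.exp_pos]) ENNReal.ofReal_ne_top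
    (hsmooth.mono fun w hw ↦ (hsub hw).1) (fun w hw v ↦ ?_) (hball y hy) (hball z hz)
  have hwt : e.target ∈ 𝓝 w := e.open_target.mem_nhds (hsub hw).1
  have hder := derivConorm_mul_norm_mfderiv_le (f := f)
    ((hsmooth.contMDiffAt hwt).mdifferentiableAt one_ne_zero)
    ((hf (e.symm w)).mdifferentiableAt one_ne_zero)
    (Filter.eventuallyEq_of_mem hwt hfg) v
  have hpos := derivConorm_pos hn hf (e.symm w)
  have hexp : Real.exp (φ (e.symm w)) = derivConorm (n := n) f (e.symm w) := Real.exp_log hpos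
  -- Both values of φ are within η/2 of φ x₀.
  have hφw : -φ (e.symm w) ≤ η - φ x := by
    have h1 : |φ (e.symm w) - φ x₀| < η / 2 := (hsub hw).2
    have h2 : |φ x - φ x₀| < η / 2 := hxφ
    linarith [(abs_lt.1 h1).1, (abs_lt.1 h2).2]
  rw [← ofReal_norm, ← ofReal_norm, ← ENNReal.ofReal_mul (Real.exp_pos _).le]
  refine ENNReal.ofReal_le_ofReal ?_
  calc ‖mfderiv (𝓡 n) (𝓡 n) e.symm w v‖
      = Real.exp (-φ (e.symm w)) * (derivConorm (n := n) f (e.symm w) *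
        ‖mfderiv (𝓡 n) (𝓡 n) e.symm w v‖) := by
        rw [← hexp, ← mul_assoc, ← Real.exp_add, neg_add_cancel, Real.exp_zero, one_mul]
    _ ≤ Real.exp (η - φ x) * ‖v‖ := by gcongr

/-! ### Shadowing on the manifold -/

/-- Shadowing of closed quasi-expanding pseudo-orbits by periodic orbits, in topological form. -/
theorem IsLocalDiffeomorph.exists_isPeriodicPt_shadowing {n : ℕ} (hn : 1 ≤ n) {M : Type*}
    [TopologicalSpace M] [T3Space M] [CompactSpace M]
    [ChartedSpace (EuclideanSpace ℝ (Fin n)) M]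
    [Bundle.RiemannianBundle (fun x : M ↦ TangentSpace (𝓡 n) x)]
    [IsManifold (𝓡 n) 1 M]
    [IsContinuousRiemannianBundle (EuclideanSpace ℝ (Fin n)) (fun x : M ↦ TangentSpace (𝓡 n) x)]
    {f : M → M} (hf : IsLocalDiffeomorph (𝓡 n) (𝓡 n) 1 f) {lam : ℝ} (hlam : 0 < lam)
    {U : Set (M × M)} (hU : U ∈ nhdsSet (diagonal M)) :
    ∃ V ∈ nhdsSet (diagonal M), ∀ (k : ℕ) (x : ℕ → M) (len : ℕ → ℕ),
      (∀ i ≤ k, 1 ≤ len i) →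
      (∀ i ≤ k, ∀ ℓ ≤ len i,
        ℓ * lam ≤ ∑ j ∈ Finset.Icc 1 ℓ, Real.log (derivConorm (n := n) f (f^[len i - j] (x i)))) →
      x (k + 1) = x 0 → (∀ i ≤ k, (x (i + 1), f^[len i] (x i)) ∈ V) →
      ∃ p, Function.IsPeriodicPt f (∑ m ∈ Finset.range (k + 1), len m) p ∧
        ∀ i ≤ k, ∀ j ≤ len i, (f^[(∑ m ∈ Finset.range i, len m) + j] p, f^[j] (x i)) ∈ U := by
  -- By compactness the neighbourhoods of the diagonal are the entourages of any compatible
  -- uniformity, so the Riemannian distance may replace the given one.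
  let : EMetricSpace M := .ofRiemannianMetric (𝓡 n) M
  have : IsRiemannianManifold (𝓡 n) M := ⟨fun _ _ ↦ rfl⟩
  obtain ⟨r₁, hr₁, H⟩ := hf.exists_hasInverseBranches hn (half_pos hlam)
  rw [nhdsSet_diagonal_eq_uniformity] at hU
  obtain ⟨r₀, hr₀, hU⟩ := mem_uniformity_edist.1 hU
  obtain ⟨r, hr, hrlt⟩ := exists_between (lt_min (lt_min hr₀ hr₁) one_pos)
  have hθ : Real.exp (lam / 2 - lam) < 1 := by
    rw [Real.exp_lt_one_iff]
    linarith
  -- Chosen as (1 - θ)r, so that θr + δ = r.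
  set δ : ENNReal := ENNReal.ofReal (1 - Real.exp (lam / 2 - lam)) * r with hδdef
  have hδ0 : 0 < δ :=
    ENNReal.mul_pos (by rw [ne_eq, ENNReal.ofReal_eq_zero, not_le]; linarith) hr.ne'
  have hδ : ENNReal.ofReal (Real.exp (lam / 2 - lam)) * r + δ ≤ r := by
    rw [hδdef, ← add_mul, ← ENNReal.ofReal_add (Real.exp_pos _).le (by linarith)]
    simp
  refine ⟨{q | edist q.1 q.2 < δ}, ?_, fun k x len hlen hx hk hV ↦ ?_⟩
  · rw [nhdsSet_diagonal_eq_uniformity]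
    exact edist_mem_uniformity hδ0
  obtain ⟨p, hp, hsh⟩ := (H.mono (hrlt.le.trans ((min_le_left _ _).trans
    (min_le_right _ _)))).exists_isPeriodicPt (half_lt_self hlam)
    (hrlt.trans_le ((min_le_right _ _).trans le_top)).ne hδ x len k hlen hx hk
    fun i hi ↦ le_of_lt (hV i hi)
  exact ⟨p, hp, fun i hi j hj ↦ hU ((hsh i hi j hj).trans_lt
    (hrlt.trans_le ((min_le_left _ _).trans (min_le_left _ _))))⟩

theorem isContinuousRiemannianBundle_of_isContMDiffRiemannianBundle {n : ℕ} {M : Type*}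
    [TopologicalSpace M] [ChartedSpace (EuclideanSpace ℝ (Fin n)) M] [IsManifold (𝓡 n) ∞ M]
    [Bundle.RiemannianBundle (fun x : M ↦ TangentSpace (𝓡 n) x)]
    [h : IsContMDiffRiemannianBundle (𝓡 n) ∞ (EuclideanSpace ℝ (Fin n))
      (fun x : M ↦ TangentSpace (𝓡 n) x)] :
    IsContinuousRiemannianBundle (EuclideanSpace ℝ (Fin n))
      (fun x : M ↦ TangentSpace (𝓡 n) x) := by
  obtain ⟨g, hg, h⟩ := h.exists_contMDiff
  exact ⟨g, hg.continuous, h⟩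

theorem le_backwardAverage_iff {n : ℕ} {M : Type*} [TopologicalSpace M]
    [ChartedSpace (EuclideanSpace ℝ (Fin n)) M]
    [Bundle.RiemannianBundle (fun x : M ↦ TangentSpace (𝓡 n) x)]
    (f : M → M) (x : M) (k : ℕ) (c : ℝ) {ℓ : ℕ} (hℓ : 1 ≤ ℓ) :
    c ≤ backwardAverage (n := n) f x k ℓ ↔
      ℓ * c ≤ ∑ j ∈ Finset.Icc 1 ℓ, Real.log (derivConorm (n := n) f (f^[k - j] x)) := by
  have h : (0 : ℝ) < ℓ := by exact_mod_cast hℓ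
  rw [backwardAverage, one_div_mul_eq_div, le_div_iff₀ h, mul_comm]

theorem theorem2p1 {n : ℕ} (hn : 1 ≤ n)
    {M : Type*} [MetricSpace M] [CompactSpace M]
    [ChartedSpace (EuclideanSpace ℝ (Fin n)) M] [IsManifold (𝓡 n) ∞ M]
    [Bundle.RiemannianBundle (fun x : M ↦ TangentSpace (𝓡 n) x)]
    [IsContMDiffRiemannianBundle (𝓡 n) ∞ (EuclideanSpace ℝ (Fin n))
      (fun x : M ↦ TangentSpace (𝓡 n) x)]
    (f : M → M) (hf : IsC1LocalDiffeo (n := n) f)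
    (ε lam : ℝ) (hε : 0 < ε) (hlam : 0 < lam) :
    ∃ δ : ℝ, 0 < δ ∧
      ∀ (k : ℕ) (x : ℕ → M) (len : ℕ → ℕ),
        (∀ i ≤ k, IsQuasiExpandingString (n := n) f lam (x i) (len i)) →
        x (k + 1) = x 0 →
        (∀ i ≤ k, dist (f^[len i] (x i)) (x (i + 1)) < δ) →
        ∃ (p : M) (τ : ℕ), τ = ∑ i ∈ Finset.range (k + 1), len i ∧ 0 < τ ∧
          Function.IsPeriodicPt f τ p ∧
          (∀ i ≤ k, ∀ j ≤ len i,
            dist (f^[(∑ m ∈ Finset.range i, len m) + j] p) (f^[j] (x i)) < ε) ∧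
          (∀ ℓ : ℕ, 1 ≤ ℓ → ℓ ≤ τ → lam - ε ≤ backwardAverage (n := n) f p τ ℓ) := by
  have : IsContinuousRiemannianBundle (EuclideanSpace ℝ (Fin n))
    (fun x : M ↦ TangentSpace (𝓡 n) x) :=
      isContinuousRiemannianBundle_of_isContMDiffRiemannianBundle
  have : IsManifold (𝓡 n) 1 M := .of_le (n := ∞) (by simp)
  set φ : M → ℝ := fun x ↦ Real.log (derivConorm (n := n) f x)
  have hφ : Continuous φ := (continuous_derivConorm hf.2.contMDiff).log
    fun x ↦ (derivConorm_pos hn hf.2 x).ne'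
  -- One neighbourhood controls both the shadowing distance and the variation of φ.
  have hU : {q : M × M | dist q.1 q.2 < ε} ∩ {q : M × M | |φ q.1 - φ q.2| < ε} ∈
      nhdsSet (diagonal M) := by
    refine ((isOpen_lt (by fun_prop) continuous_const).inter
      (isOpen_lt (by fun_prop) continuous_const)).mem_nhdsSet.2 ?_
    rintro ⟨a, b⟩ hab
    obtain rfl : a = b := hab
    exact ⟨by simpa using hε, by simpa using hε⟩
  obtain ⟨V, hV, hmain⟩ := hf.2.exists_isPeriodicPt_shadowing hn hlam hU
  rw [nhdsSet_diagonal_eq_uniformity] at hV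
  obtain ⟨δ, hδ, hδV⟩ := Metric.mem_uniformity_dist.1 hV
  refine ⟨δ, hδ, fun k x len hx hk hjump ↦ ?_⟩
  have hsum : ∀ i ≤ k, ∀ ℓ ≤ len i,
      ℓ * lam ≤ ∑ j ∈ Finset.Icc 1 ℓ, φ (f^[len i - j] (x i)) := fun i hi ℓ hℓ ↦ by
    rcases Nat.eq_zero_or_pos ℓ with rfl | hpos
    · simp
    · exact (le_backwardAverage_iff f (x i) (len i) lam hpos).1 ((hx i hi).2 ℓ hpos hℓ)
  obtain ⟨p, hp, hsh⟩ := hmain k x len (fun i hi ↦ (hx i hi).1) hsum hk fun i hi ↦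
    hδV (by rw [dist_comm]; exact hjump i hi)
  refine ⟨p, _, rfl, ?_, hp, fun i hi j hj ↦ (hsh i hi j hj).1, fun ℓ hℓ hℓτ ↦ ?_⟩
  · rw [Finset.sum_range_succ]
    have := (hx k le_rfl).1
    omega
  rw [le_backwardAverage_iff f p _ _ hℓ]
  refine le_backward_sum_of_strings (fun t ↦ φ (f^[t] p)) (lam - ε) len k
    (fun i hi ℓ' hℓ' ↦ ?_) ℓ hℓτ
  have h1 := hsum i hi ℓ' hℓ'
  have h2 : ∑ j ∈ Finset.Icc 1 ℓ', (φ (f^[len i - j] (x i)) - ε) ≤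
      ∑ j ∈ Finset.Icc 1 ℓ', φ (f^[(∑ m ∈ Finset.range i, len m) + (len i - j)] p) := by
    refine Finset.sum_le_sum fun j _ ↦ ?_
    have h3 : |φ (f^[(∑ m ∈ Finset.range i, len m) + (len i - j)] p) -
      φ (f^[len i - j] (x i))| < ε := (hsh i hi (len i - j) (Nat.sub_le _ _)).2
    linarith [(abs_lt.1 h3).1]
  rw [Finset.sum_sub_distrib, Finset.sum_const, Nat.card_Icc, nsmul_eq_mul,
    Nat.add_sub_cancel] at h2
  rw [mul_sub]
  linarith
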